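/- Use the Fourier transform $\widehat f(\xi)=\int_{\mathbb R^3}e^{-ix\cdot\xi}f(x)\,dx$ (extended to $L^2(\mathbb R^3)$) with inverse $\mathcal F^{-1}g(x)=(2\pi)^{-3}\int_{\mathbb R^3}e^{ix\cdot\xi}g(\xi)\,d\xi$. Fix a real-valued $\psi\in C_0^\infty(\mathbb R^3)$ with $0\le\psi\le1$, $\operatorname{supp}\psi\subset[-1,1]^3$, $\psi(-\xi)=\psi(\xi)$ and $\sum_{k\in\mathbb Z^3}\psi(\xi-k)=1$ for all $\xi\in\mathbb R^3$, and for $k\in\mathbb Z^3$ set $f_k=\mathcal F^{-1}\big(\psi(\cdot-k)\widehat f\,\big)$. For $\epsilon>0$ let $H^\epsilon(\mathbb R^3)=\{f\in L^2(\mathbb R^3;\mathbb C): |\nabla|^\epsilon f\in L^2\}$, where $|\nabla|^\epsilon f=\mathcal F^{-1}(|\xi|^\epsilon\widehat f\,)$, with norm $\|f\|_{H^\epsilon}=\|f\|_{L^2}+\||\nabla|^\epsilon f\|_{L^2}$. **Lemma.** For every $\epsilon>0$ there is a constant $C_\epsilon>0$ (depending only on $\epsilon$ and the fixed $\psi$)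 such that for all $2\le r\le\infty$ and all radial $f\in H^\epsilon(\mathbb R^3)$, $$\Big\|\,|x|^{1-\frac2r}\Big(\sum_{k\in\mathbb Z^3}|f_k(x)|^2\Big)^{1/2}\Big\|_{L^r_x(\mathbb R^3)}\le C_\epsilon\,\|f\|_{H^\epsilon(\mathbb R^3)},$$ where $2/r=0$ if $r=\infty$. -/

import Mathlib

namespace RadialSobolev

open MeasureTheory FourierTransform
open scoped ENNReal ContDiff

/-- Euclidean space `ℝ³`, with the Euclidean norm and Lebesgue measure. -/
abbrev R3 : Type := EuclideanSpace ℝ (Fin 3)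

/-- The Hilbert space `L²(ℝ³; ℂ)`. -/
abbrev L2 : Type := Lp ℂ 2 (volume : Measure R3)

/-- The lattice point `k ∈ ℤ³`, regarded as a vector of `ℝ³`. -/
def latticePoint (k : Fin 3 → ℤ) : R3 := WithLp.toLp 2 (fun i => (k i : ℝ))

/-- The window functions of the unit-scale frequency decomposition: `ψ` is smooth and real-valued,
`0 ≤ ψ ≤ 1`, its support lies in `[-1,1]³`, it is even, and its integer translates sum to one. -/
structure IsUnitWindow (ψ : R3 → ℝ) : Prop where
  smooth : ContDiff ℝ ∞ ψ
  nonneg : ∀ ξ, 0 ≤ ψ ξ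
  le_one : ∀ ξ, ψ ξ ≤ 1
  support : tsupport ψ ⊆ {ξ | ∀ i, |ξ i| ≤ 1}
  even : ∀ ξ, ψ (-ξ) = ψ ξ
  partition : ∀ ξ, HasSum (fun k : Fin 3 → ℤ => ψ (ξ - latticePoint k)) 1

/-- The Fourier transform `f̂(ξ) = ∫ e^{-i x·ξ} f(x) dx`, extended to `L²`. Mathlib's transform `𝓕`
on `L²` extends `∫ e^{-2πi x·η} f(x) dx`, whence the substitution `η = ξ / (2π)`. -/
noncomputable def fourier (f : L2) : R3 → ℂ :=
  fun ξ => (𝓕 f : L2) ((2 * Real.pi)⁻¹ • ξ)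

/-- The inverse Fourier transform `(2π)⁻³ ∫ e^{i x·ξ} g(ξ) dξ` of an integrable function `g`. -/
noncomputable def fourierInv (g : R3 → ℂ) : R3 → ℂ :=
  fun x => (((2 * Real.pi) ^ 3)⁻¹ : ℂ) *
    ∫ ξ, Complex.exp (Complex.I * (inner ℝ x ξ : ℝ)) * g ξ

/-- The frequency piece `f_k`, the inverse Fourier transform of `ψ(ξ - k) f̂(ξ)`. The latter is
square integrable with compact support, hence integrable, so that `f_k` is defined at every point
by the inversion integral. -/
noncomputable def piece (ψ : R3 → ℝ) (k : Fin 3 → ℤ) (f : L2) : R3 → ℂ :=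
  fourierInv (fun ξ => (ψ (ξ - latticePoint k) : ℂ) * fourier f ξ)

/-- The square function `x ↦ (∑_{k ∈ ℤ³} |f_k(x)|²)^{1/2}`, with values in `[0,∞]`. -/
noncomputable def squareFunction (ψ : R3 → ℝ) (f : L2) : R3 → ℝ≥0∞ :=
  fun x => (∑' k : Fin 3 → ℤ, ‖piece ψ k f x‖ₑ ^ (2 : ℝ)) ^ (1 / 2 : ℝ)

/-- A class `f ∈ L²` is radial if almost everywhere it depends on `|x|` only. -/
def IsRadial (f : L2) : Prop :=
  ∃ f₀ : ℝ → ℂ, ∀ᵐ x : R3, f x = f₀ ‖x‖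

/-- `f ∈ H^s = Ḣ^s ∩ L²`: the function `|ξ|^s f̂(ξ)`, here written at `ξ = 2πη`, belongs to `L²`. -/
def MemH (s : ℝ) (f : L2) : Prop :=
  MemLp (fun η : R3 => (((2 * Real.pi * ‖η‖) ^ s : ℝ) : ℂ) * (𝓕 f : L2) η) 2 volume

/-- The fractional derivative `|∇|^s f ∈ L²`, whose Fourier transform is `|ξ|^s f̂(ξ)`. -/
noncomputable def absNabla (s : ℝ) (f : L2) (hf : MemH s f) : L2 :=
  𝓕⁻ (MemLp.toLp _ hf : L2)

/-- The norm `‖f‖_{L²} + ‖|∇|^s f‖_{L²}` of `H^s = Ḣ^s ∩ L²`. -/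
noncomputable def normH (s : ℝ) (f : L2) (hf : MemH s f) : ℝ :=
  ‖f‖ + ‖absNabla s f hf‖

end RadialSobolev

/-! ### Frequency pieces as modulated convolutions. -/

namespace RadialSobolev

open MeasureTheory FourierTransform SchwartzMap
open scoped ENNReal ContDiff

/-! The estimate holds with `‖f‖` alone on the right, and `‖f‖` is a summand of `normH`. The pieces
`f_k(x)` are, up to a phase convention, Fourier coefficients at the lattice points of the single
function `Φ (y - x) * f y`, with `Φ` Schwartz (`exists_piece_eq_integral`). A Bessel-type inequality
therefore bounds `∑ |f_k(x)|²` by the mass of `f` near `x`, namely `localMass f x`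
(`exists_tsum_piece_le`). It is proved by duality from a weighted mean-square bound for
trigonometric polynomials (`exists_lintegral_weight_mul_trigPoly_le`).

For radial `f` the local mass is constant on spheres, so it can be averaged over a piece of the
sphere of radius `|x|`, of area comparable to `|x|²`. Since the kernel is integrable along two
coordinates, this gives `|x|² localMass f x ≲ ‖f‖²`, the endpoint `r = ∞`. Integrating the local
mass over `x` gives the endpoint `r = 2`, and `eLpNorm_weight_mul_le` interpolates. -/

/-- A unit window is compactly supported. -/
lemma IsUnitWindow.hasCompactSupport {ψ : R3 → ℝ} (hψ : IsUnitWindow ψ) :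
    HasCompactSupport ψ := by
  refine HasCompactSupport.of_support_subset_isCompact
    (isCompact_closedBall (0 : R3) 2) ((subset_tsupport ψ).trans (hψ.support.trans ?_))
  intro ξ hξ
  rw [mem_closedBall_zero_iff, EuclideanSpace.norm_eq, Real.sqrt_le_left (by norm_num)]
  have h (i : Fin 3) : ‖ξ i‖ ^ 2 ≤ 1 := by
    have := hξ i
    rw [Real.norm_eq_abs]
    nlinarith [abs_nonneg (ξ i)]
  simp only [Fin.sum_univ_three]
  linarith [h 0, h 1, h 2]

/-- The translated, dilated and modulated window as a Schwartz function. -/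
lemma exists_schwartz_modulated {ψ : R3 → ℝ} (hψ : IsUnitWindow ψ) (x κ : R3) :
    ∃ h : 𝓢(R3, ℂ), ∀ η, h η =
      Complex.exp (Complex.I * (inner ℝ x ((2 * Real.pi) • η) : ℝ)) *
        (ψ ((2 * Real.pi) • η - κ) : ℂ) := by
  have hpi : (2 * Real.pi) ≠ 0 := by positivity
  let e : R3 ≃ₜ R3 := (Homeomorph.smulOfNeZero (2 * Real.pi) hpi).trans (Homeomorph.subRight κ)
  have h1 : HasCompactSupport (fun η : R3 => ψ ((2 * Real.pi) • η - κ)) :=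
    hψ.hasCompactSupport.comp_homeomorph e
  have h2 : HasCompactSupport (fun η : R3 =>
      Complex.exp (Complex.I * (inner ℝ x ((2 * Real.pi) • η) : ℝ)) *
        (ψ ((2 * Real.pi) • η - κ) : ℂ)) :=
    (h1.comp_left (g := fun r : ℝ => (r : ℂ)) Complex.ofReal_zero).mul_left
  have h3 : ContDiff ℝ ∞ (fun η : R3 =>
      Complex.exp (Complex.I * (inner ℝ x ((2 * Real.pi) • η) : ℝ)) *
        (ψ ((2 * Real.pi) • η - κ) : ℂ)) := by
    have h4 : ContDiff ℝ ∞ (fun η : R3 => ψ ((2 * Real.pi) • η - κ)) :=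
      hψ.smooth.comp (by fun_prop)
    have h5 : ContDiff ℝ ∞ (fun η : R3 => inner ℝ x ((2 * Real.pi) • η)) :=
      contDiff_const.inner ℝ (contDiff_id.const_smul (2 * Real.pi))
    exact (contDiff_const.mul (Complex.ofRealCLM.contDiff.comp h5)).cexp.mul
      (Complex.ofRealCLM.contDiff.comp h4)
  exact ⟨h2.toSchwartzMap h3, fun η => rfl⟩

/-- The `L²` Fourier transform is self-adjoint for the bilinear pairing with Schwartz functions. -/
lemma integral_schwartz_mul_fourier (h : 𝓢(R3, ℂ)) (f : L2) :
    ∫ η, h η * (𝓕 f : L2) η = ∫ y, (𝓕 h) y * f y := by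
  have := congrArg (fun T => T h) (Lp.fourier_toTemperedDistribution_eq f)
  simp only [TemperedDistribution.fourier_apply, Lp.toTemperedDistribution_apply,
    smul_eq_mul] at this
  exact this.symm

/-- The frequency piece as the pairing of the dilated integrand with the Fourier transform. -/
lemma piece_eq_integral_fourier (ψ : R3 → ℝ) (k : Fin 3 → ℤ) (f : L2) (x : R3) :
    piece ψ k f x = ∫ η, (Complex.exp (Complex.I * (inner ℝ x ((2 * Real.pi) • η) : ℝ)) *
        (ψ ((2 * Real.pi) • η - latticePoint k) : ℂ)) * (𝓕 f : L2) η := by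
  have hpi : (2 * Real.pi) ≠ 0 := by positivity
  have h := Measure.integral_comp_smul (volume : Measure R3) (fun ξ : R3 =>
    Complex.exp (Complex.I * (inner ℝ x ξ : ℝ)) *
      ((ψ (ξ - latticePoint k) : ℂ) * (𝓕 f : L2) ((2 * Real.pi)⁻¹ • ξ))) (2 * Real.pi)
  simp only [smul_smul, inv_mul_cancel₀ hpi, one_smul, finrank_euclideanSpace_fin] at h
  simp only [piece, fourierInv, fourier]
  rw [abs_of_pos (by positivity)] at h
  simp only [mul_assoc] at h ⊢
  rw [h, Complex.real_smul]
  push_cast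
  rfl

/-- Each frequency piece is the pairing of `f` with a modulated translate of one fixed
Schwartz function. -/
lemma exists_piece_eq_integral {ψ : R3 → ℝ} (hψ : IsUnitWindow ψ) :
    ∃ Φ : 𝓢(R3, ℂ), ∀ (k : Fin 3 → ℤ) (f : L2) (x : R3),
      piece ψ k f x =
        ∫ y, Complex.exp (-(Complex.I * (inner ℝ (y - x) (latticePoint k) : ℝ))) *
          Φ (y - x) * f y := by
  have hpi : (2 * Real.pi) ≠ 0 := by positivity
  obtain ⟨g, hg⟩ := exists_schwartz_modulated hψ 0 0
  refine ⟨𝓕 g, fun k f x => ?_⟩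
  obtain ⟨h, hh⟩ := exists_schwartz_modulated hψ x (latticePoint k)
  have hF (y : R3) : (𝓕 h) y =
      Complex.exp (-(Complex.I * (inner ℝ (y - x) (latticePoint k) : ℝ))) * (𝓕 g) (y - x) := by
    -- Shifting `η` by `k / (2π)` recentres the window at the origin; only phases remain.
    rw [SchwartzMap.fourier_coe, SchwartzMap.fourier_coe, Real.fourier_eq', Real.fourier_eq',
      ← integral_add_right_eq_self _ ((2 * Real.pi)⁻¹ • latticePoint k), ← integral_const_mul]
    refine integral_congr_ae (Filter.Eventually.of_forall fun η => ?_)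
    simp only [hh, hg, smul_eq_mul, inner_zero_left, Complex.ofReal_zero, mul_zero,
      Complex.exp_zero, one_mul, sub_zero, smul_add, smul_smul, add_sub_cancel_right, mul_inv_cancel₀ hpi, one_smul]
    rw [← mul_assoc, ← mul_assoc, ← Complex.exp_add, ← Complex.exp_add]
    congr 2
    simp only [inner_sub_left, inner_sub_right, inner_add_left, inner_add_right, inner_smul_left,
      inner_smul_right, RCLike.conj_to_real, real_inner_comm y η, real_inner_comm x η,
      real_inner_comm y (latticePoint k)]
    push_cast
    field_simp
    ring
  rw [piece_eq_integral_fourier]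
  simp only [← hh]
  rw [integral_schwartz_mul_fourier]
  simp only [hF]

end RadialSobolev

/-! ### Weighted mean squares of trigonometric polynomials. -/

namespace RadialSobolev

open MeasureTheory
open scoped ENNReal ContDiff

/-- The trigonometric polynomial with frequencies in a finite set of lattice points. -/
noncomputable def trigPoly (F : Finset (Fin 3 → ℤ)) (c : (Fin 3 → ℤ) → ℂ) (y : R3) : ℂ :=
  ∑ k ∈ F, c k * Complex.exp (-(Complex.I * (inner ℝ y (latticePoint k) : ℝ)))

lemma continuous_trigPoly (F : Finset (Fin 3 → ℤ)) (c : (Fin 3 → ℤ) → ℂ) :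
    Continuous (trigPoly F c) := by
  unfold trigPoly
  fun_prop

/-- The pairwise interaction of two characters against a Gaussian. -/
lemma integral_gaussian_character {t : ℝ} (ht : 0 < t) (w : R3) :
    ‖∫ y : R3, Complex.exp (-(t : ℂ) * (‖y‖ : ℂ) ^ 2 + (-Complex.I) * (inner ℝ w y : ℝ))‖ =
      (Real.pi / t) ^ (3 / 2 : ℝ) * Real.exp (-(‖w‖ ^ 2 / (4 * t))) := by
  rw [GaussianFourier.integral_cexp_neg_mul_sq_norm_add (by simpa using ht)]
  have h1 : ((Real.pi : ℂ) / (t : ℂ)) ^ (((Module.finrank ℝ R3 : ℕ) : ℂ) / 2) =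
      (((Real.pi / t) ^ (3 / 2 : ℝ) : ℝ) : ℂ) := by
    rw [Complex.ofReal_cpow (by positivity)]
    simp
  have h2 : Complex.exp ((-Complex.I) ^ 2 * (‖w‖ : ℂ) ^ 2 / (4 * (t : ℂ))) =
      ((Real.exp (-(‖w‖ ^ 2 / (4 * t))) : ℝ) : ℂ) := by
    rw [neg_sq, Complex.I_sq]
    push_cast
    congr 1
    ring
  rw [h1, h2, ← Complex.ofReal_mul, Complex.norm_real, Real.norm_of_nonneg (by positivity)]

/-- The lattice weight `∏ (1 + mᵢ²)⁻¹`. -/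
noncomputable def latticeWeight (m : Fin 3 → ℤ) : ℝ := ∏ i, (1 + (m i : ℝ) ^ 2)⁻¹

lemma latticeWeight_nonneg (m : Fin 3 → ℤ) : 0 ≤ latticeWeight m :=
  Finset.prod_nonneg fun i _ => by positivity

lemma latticeWeight_neg (m : Fin 3 → ℤ) : latticeWeight (-m) = latticeWeight m := by
  simp [latticeWeight]

lemma summable_inv_one_add_int_sq : Summable fun n : ℤ => (1 + (n : ℝ) ^ 2)⁻¹ := by
  refine Summable.of_norm_bounded_eventually
    (Real.summable_one_div_int_pow.mpr (show 1 < 2 by norm_num)) ?_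
  filter_upwards [Filter.eventually_cofinite_ne (0 : ℤ)] with n hn
  have hn' : (0 : ℝ) < (n : ℝ) ^ 2 := by positivity
  rw [Real.norm_of_nonneg (by positivity), one_div]
  exact inv_anti₀ hn' (by linarith)

/-- Enlarging `F` to a cube makes the sum of the product weight factor into three one-dimensional
sums. -/
lemma sum_latticeWeight_le (F : Finset (Fin 3 → ℤ)) :
    ∑ m ∈ F, latticeWeight m ≤ (∑' n : ℤ, (1 + (n : ℝ) ^ 2)⁻¹) ^ 3 := by
  classical
  let s : Finset ℤ := Finset.univ.biUnion fun i : Fin 3 => F.image fun m => m i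
  have hF : F ⊆ Fintype.piFinset fun _ : Fin 3 => s := by
    intro m hm
    rw [Fintype.mem_piFinset]
    intro i
    exact Finset.mem_biUnion.mpr ⟨i, Finset.mem_univ _, Finset.mem_image_of_mem _ hm⟩
  calc ∑ m ∈ F, latticeWeight m
      ≤ ∑ m ∈ Fintype.piFinset fun _ : Fin 3 => s, latticeWeight m :=
        Finset.sum_le_sum_of_subset_of_nonneg hF fun m _ _ => latticeWeight_nonneg m
    _ = (∑ n ∈ s, (1 + (n : ℝ) ^ 2)⁻¹) ^ 3 := by
        simp only [latticeWeight]
        rw [Finset.sum_prod_piFinset s fun _ n => (1 + (n : ℝ) ^ 2)⁻¹]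
        simp
    _ ≤ _ := by
        gcongr
        exact summable_inv_one_add_int_sq.sum_le_tsum s fun n _ => by positivity

/-- Both sides factor over coordinates, and each factor follows from `1 + u ≤ exp u`. The growth in
`t` is only polynomial, so `exp (-t)` can later absorb it. -/
lemma exp_neg_latticePoint_le {t : ℝ} (ht : 0 < t) (m : Fin 3 → ℤ) :
    Real.exp (-(‖latticePoint m‖ ^ 2 / (4 * t))) ≤ (1 + 4 * t) ^ 3 * latticeWeight m := by
  have h (i : Fin 3) :
      Real.exp (-((m i : ℝ) ^ 2 / (4 * t))) ≤ (1 + 4 * t) * (1 + (m i : ℝ) ^ 2)⁻¹ := by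
    rw [Real.exp_neg, ← div_eq_mul_inv, inv_eq_one_div, div_le_div_iff₀ (by positivity)
      (by positivity)]
    have h1 := Real.add_one_le_exp ((m i : ℝ) ^ 2 / (4 * t))
    calc 1 * (1 + (m i : ℝ) ^ 2)
        ≤ (1 + 4 * t) * ((m i : ℝ) ^ 2 / (4 * t) + 1) := by
          have : (1 + 4 * t) * ((m i : ℝ) ^ 2 / (4 * t) + 1) =
            1 + (m i : ℝ) ^ 2 + (4 * t + (m i : ℝ) ^ 2 / (4 * t)) := by
            field_simp
            ring
          rw [this]
          have : 0 ≤ 4 * t + (m i : ℝ) ^ 2 / (4 * t) := by positivity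
          linarith
      _ ≤ _ := by gcongr
  have h2 : Real.exp (-(‖latticePoint m‖ ^ 2 / (4 * t))) =
      ∏ i, Real.exp (-((m i : ℝ) ^ 2 / (4 * t))) := by
    rw [← Real.exp_sum, EuclideanSpace.real_norm_sq_eq]
    simp [latticePoint, Finset.sum_div]
  rw [h2, latticeWeight]
  calc ∏ i, Real.exp (-((m i : ℝ) ^ 2 / (4 * t)))
      ≤ ∏ i, ((1 + 4 * t) * (1 + (m i : ℝ) ^ 2)⁻¹) :=
        Finset.prod_le_prod (fun i _ => (Real.exp_pos _).le) fun i _ => h i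
    _ = _ := by simp [Finset.prod_mul_distrib]

/-- Schur's test for a convolution matrix with a nonnegative even kernel. -/
lemma sum_sum_mul_le_of_even {G : Type*} [AddCommGroup G] (F : Finset G) (a q : G → ℝ) {Q : ℝ}
    (hq : ∀ m, 0 ≤ q m) (heven : ∀ m, q (-m) = q m) (hQ : ∀ F : Finset G, ∑ m ∈ F, q m ≤ Q) :
    ∑ k ∈ F, ∑ l ∈ F, a k * a l * q (k - l) ≤ Q * ∑ k ∈ F, a k ^ 2 := by
  classical
  have h1 (k : G) : ∑ l ∈ F, q (k - l) ≤ Q := by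
    refine le_of_eq_of_le ?_ (hQ (F.image fun l => k - l))
    rw [Finset.sum_image fun x _ y _ h => sub_right_injective h]
  have h2 : ∑ k ∈ F, ∑ l ∈ F, a k ^ 2 * q (k - l) ≤ Q * ∑ k ∈ F, a k ^ 2 := by
    rw [Finset.mul_sum]
    refine Finset.sum_le_sum fun k _ => ?_
    rw [← Finset.mul_sum, mul_comm]
    exact mul_le_mul_of_nonneg_right (h1 k) (sq_nonneg _)
  -- Evenness of `q` makes the two halves of `2 a_k a_l ≤ a_k² + a_l²` contribute equally.
  have h3 : ∑ k ∈ F, ∑ l ∈ F, a l ^ 2 * q (k - l) = ∑ k ∈ F, ∑ l ∈ F, a k ^ 2 * q (k - l) := by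
    rw [Finset.sum_comm]
    refine Finset.sum_congr rfl fun k _ => Finset.sum_congr rfl fun l _ => ?_
    rw [← heven, neg_sub]
  calc ∑ k ∈ F, ∑ l ∈ F, a k * a l * q (k - l)
      ≤ ∑ k ∈ F, ∑ l ∈ F, (a k ^ 2 * q (k - l) + a l ^ 2 * q (k - l)) / 2 := by
        refine Finset.sum_le_sum fun k _ => Finset.sum_le_sum fun l _ => ?_
        nlinarith [mul_nonneg (sq_nonneg (a k - a l)) (hq (k - l))]
    _ = (∑ k ∈ F, ∑ l ∈ F, a k ^ 2 * q (k - l) + ∑ k ∈ F, ∑ l ∈ F, a l ^ 2 * q (k - l)) / 2 := by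
        simp only [← Finset.sum_div, Finset.sum_add_distrib]
    _ ≤ _ := by rw [h3]; linarith

lemma latticePoint_sub (k l : Fin 3 → ℤ) :
    latticePoint (k - l) = latticePoint k - latticePoint l := by
  ext i
  simp [latticePoint]

/-- The Gaussian-weighted mean square of a trigonometric polynomial. -/
lemma lintegral_gaussian_mul_trigPoly_le :
    ∃ K : ℝ, 0 ≤ K ∧ ∀ (t : ℝ), 0 < t → ∀ (F : Finset (Fin 3 → ℤ)) (c : (Fin 3 → ℤ) → ℂ),
      ∫⁻ y, ENNReal.ofReal (Real.exp (-(t * ‖y‖ ^ 2)) * ‖trigPoly F c y‖ ^ 2) ≤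
        ENNReal.ofReal (t ^ (-(3 / 2) : ℝ) * (K * (1 + 4 * t) ^ 3 * ∑ k ∈ F, ‖c k‖ ^ 2)) := by
  set Q := (∑' n : ℤ, (1 + (n : ℝ) ^ 2)⁻¹) ^ 3 with hQ
  have hQ0 : 0 ≤ Q := pow_nonneg (tsum_nonneg fun n => by positivity) 3
  refine ⟨Real.pi ^ (3 / 2 : ℝ) * Q, by positivity, fun t ht F c => ?_⟩
  let e (k l : Fin 3 → ℤ) (y : R3) : ℂ := Complex.exp (-(t : ℂ) * (‖y‖ : ℂ) ^ 2 +
    (-Complex.I) * (inner ℝ (latticePoint (k - l)) y : ℝ))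
  have he (k l) : Integrable (e k l) :=
    GaussianFourier.integrable_cexp_neg_mul_sq_norm_add (by simpa using ht) _ _
  have hsq (y : R3) : ((Real.exp (-(t * ‖y‖ ^ 2)) * ‖trigPoly F c y‖ ^ 2 : ℝ) : ℂ) =
      ∑ k ∈ F, ∑ l ∈ F, (c k * (starRingEnd ℂ) (c l)) * e k l y := by
    have h1 : ((‖trigPoly F c y‖ ^ 2 : ℝ) : ℂ) =
        trigPoly F c y * (starRingEnd ℂ) (trigPoly F c y) := by
      rw [Complex.mul_conj, Complex.normSq_eq_norm_sq]
    rw [Complex.ofReal_mul, h1]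
    simp only [trigPoly, map_sum, map_mul]
    rw [Finset.sum_mul_sum, Finset.mul_sum]
    refine Finset.sum_congr rfl fun k _ => ?_
    rw [Finset.mul_sum]
    refine Finset.sum_congr rfl fun l _ => ?_
    have h2 : e k l y = Complex.exp (-(t : ℂ) * (‖y‖ : ℂ) ^ 2) *
        (Complex.exp (-(Complex.I * (inner ℝ y (latticePoint k) : ℝ))) *
          Complex.exp (Complex.I * (inner ℝ y (latticePoint l) : ℝ))) := by
      simp only [e, ← Complex.exp_add]
      congr 1
      rw [latticePoint_sub, inner_sub_left, real_inner_comm y, real_inner_comm y]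
      push_cast
      ring
    rw [h2, ← Complex.exp_conj]
    simp only [map_neg, map_mul, Complex.conj_I, Complex.conj_ofReal]
    push_cast
    ring_nf
  have hint : Integrable fun y : R3 => Real.exp (-(t * ‖y‖ ^ 2)) * ‖trigPoly F c y‖ ^ 2 := by
    have : Integrable fun y : R3 =>
        ((Real.exp (-(t * ‖y‖ ^ 2)) * ‖trigPoly F c y‖ ^ 2 : ℝ) : ℂ) := by
      simp only [hsq]
      exact integrable_finsetSum _ fun k _ => integrable_finsetSum _ fun l _ =>
        (he k l).const_mul _
    exact this.re
  rw [← ofReal_integral_eq_lintegral_ofReal hint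
    (Filter.Eventually.of_forall fun y => by positivity)]
  refine ENNReal.ofReal_le_ofReal ?_
  have hnn : 0 ≤ ∫ y : R3, Real.exp (-(t * ‖y‖ ^ 2)) * ‖trigPoly F c y‖ ^ 2 :=
    integral_nonneg fun y => by positivity
  rw [← Real.norm_of_nonneg hnn, ← Complex.norm_real, ← integral_complex_ofReal]
  simp only [hsq]
  rw [integral_finsetSum _ fun k _ => integrable_finsetSum _ fun l _ => (he k l).const_mul _]
  have hD : 0 ≤ (Real.pi / t) ^ (3 / 2 : ℝ) * (1 + 4 * t) ^ 3 := by positivity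
  calc ‖∑ k ∈ F, ∫ y, ∑ l ∈ F, (c k * (starRingEnd ℂ) (c l)) * e k l y‖
      ≤ ∑ k ∈ F, ∑ l ∈ F, ‖c k‖ * ‖c l‖ *
          ((Real.pi / t) ^ (3 / 2 : ℝ) * (1 + 4 * t) ^ 3 * latticeWeight (k - l)) := by
        refine (norm_sum_le _ _).trans (Finset.sum_le_sum fun k _ => ?_)
        rw [integral_finsetSum _ fun l _ => (he k l).const_mul _]
        refine (norm_sum_le _ _).trans (Finset.sum_le_sum fun l _ => ?_)
        rw [integral_const_mul, norm_mul, norm_mul, RCLike.norm_conj,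
          integral_gaussian_character ht, mul_assoc ((Real.pi / t) ^ (3 / 2 : ℝ))]
        gcongr
        exact exp_neg_latticePoint_le ht _
    _ ≤ ((Real.pi / t) ^ (3 / 2 : ℝ) * (1 + 4 * t) ^ 3 * Q) * ∑ k ∈ F, ‖c k‖ ^ 2 := by
        refine sum_sum_mul_le_of_even F (fun k => ‖c k‖)
          (fun m => (Real.pi / t) ^ (3 / 2 : ℝ) * (1 + 4 * t) ^ 3 * latticeWeight m)
          (fun m => mul_nonneg hD (latticeWeight_nonneg m))
          (fun m => by simp only [latticeWeight_neg]) fun F' => ?_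
        rw [← Finset.mul_sum]
        exact mul_le_mul_of_nonneg_left (sum_latticeWeight_le F') hD
    _ = _ := by
        rw [Real.div_rpow Real.pi_pos.le ht.le, Real.rpow_neg ht.le]
        ring

/-- Superposition of Gaussians yields the polynomial weight. -/
lemma lintegral_gaussian_superposition (s : ℝ) (hs : 0 < s) :
    ∫⁻ t in Set.Ioi (0 : ℝ), ENNReal.ofReal (t ^ (3 / 2 : ℝ) * Real.exp (-(s * t))) =
      ENNReal.ofReal (s ^ (-(5 / 2) : ℝ) * Real.Gamma (5 / 2)) := by
  have h := Real.integral_rpow_mul_exp_neg_mul_Ioi (a := 5 / 2) (by norm_num) hs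
  rw [show (5 / 2 : ℝ) - 1 = 3 / 2 by norm_num, one_div, Real.inv_rpow hs.le,
    ← Real.rpow_neg hs.le] at h
  rw [← h, ofReal_integral_eq_lintegral_ofReal]
  -- A non-integrable integrand would have Bochner integral zero, but the value is a positive
  -- multiple of `Γ(5/2)`.
  · by_contra hni
    rw [integral_undef hni] at h
    exact (mul_pos (Real.rpow_pos_of_pos hs (-(5 / 2)))
      (Real.Gamma_pos_of_pos (show (0 : ℝ) < 5 / 2 by norm_num))).ne h
  · filter_upwards [ae_restrict_mem measurableSet_Ioi] with t ht
    have : (0 : ℝ) < t := ht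
    positivity

/-- The mean square of a trigonometric polynomial against the weight `(1 + |y|²)^{-5/2}`. -/
lemma exists_lintegral_weight_mul_trigPoly_le :
    ∃ B : ℝ, 0 ≤ B ∧ ∀ (F : Finset (Fin 3 → ℤ)) (c : (Fin 3 → ℤ) → ℂ),
      ∫⁻ y, ENNReal.ofReal ((1 + ‖y‖ ^ 2) ^ (-(5 / 2) : ℝ) * ‖trigPoly F c y‖ ^ 2) ≤
        ENNReal.ofReal (B * ∑ k ∈ F, ‖c k‖ ^ 2) := by
  obtain ⟨K, hK0, hK⟩ := lintegral_gaussian_mul_trigPoly_le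
  have hG := Real.Gamma_pos_of_pos (show (0 : ℝ) < 5 / 2 by norm_num)
  -- Here `4096 = 16³` comes from `1 + 4t ≤ 16 exp (t/4)`, and `4` is the integral of `exp (-t/4)`
  -- over `t > 0`.
  refine ⟨(Real.Gamma (5 / 2))⁻¹ * (K * 4096 * 4), by positivity, fun F c => ?_⟩
  set S := ∑ k ∈ F, ‖c k‖ ^ 2 with hS
  have hS0 : 0 ≤ S := Finset.sum_nonneg fun k _ => by positivity
  have hP := continuous_trigPoly F c
  -- The exponent `5/2` gives the density `t^(3/2)`, which cancels the factor `t^(-3/2)` of the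
  -- Gaussian bound.
  have h1 (y : R3) : ENNReal.ofReal ((1 + ‖y‖ ^ 2) ^ (-(5 / 2) : ℝ) * ‖trigPoly F c y‖ ^ 2) =
      ENNReal.ofReal (Real.Gamma (5 / 2))⁻¹ * ∫⁻ t in Set.Ioi (0 : ℝ),
        ENNReal.ofReal (t ^ (3 / 2 : ℝ) * Real.exp (-((1 + ‖y‖ ^ 2) * t))) *
          ENNReal.ofReal (‖trigPoly F c y‖ ^ 2) := by
    rw [lintegral_mul_const' _ _ ENNReal.ofReal_ne_top,
      lintegral_gaussian_superposition _ (by positivity), ← ENNReal.ofReal_mul (by positivity),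
      ← ENNReal.ofReal_mul (by positivity)]
    congr 1
    field_simp
  simp only [h1]
  rw [lintegral_const_mul' _ _ ENNReal.ofReal_ne_top, lintegral_lintegral_swap]
  swap
  · refine Measurable.aemeasurable ?_
    simp only [Function.uncurry_def]
    have : Measurable fun z : R3 × ℝ => trigPoly F c z.1 := hP.measurable.comp measurable_fst
    fun_prop
  have h2 : ∀ t ∈ Set.Ioi (0 : ℝ), ∫⁻ y : R3,
      ENNReal.ofReal (t ^ (3 / 2 : ℝ) * Real.exp (-((1 + ‖y‖ ^ 2) * t))) *
          ENNReal.ofReal (‖trigPoly F c y‖ ^ 2) ≤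
      ENNReal.ofReal (K * 4096 * S * Real.exp (-(1 / 4) * t)) := by
    intro t ht
    have ht : 0 < t := ht
    have h3 (y : R3) : ENNReal.ofReal (t ^ (3 / 2 : ℝ) * Real.exp (-((1 + ‖y‖ ^ 2) * t))) *
          ENNReal.ofReal (‖trigPoly F c y‖ ^ 2) = ENNReal.ofReal (t ^ (3 / 2 : ℝ) * Real.exp (-t)) *
        ENNReal.ofReal (Real.exp (-(t * ‖y‖ ^ 2)) * ‖trigPoly F c y‖ ^ 2) := by
      rw [← ENNReal.ofReal_mul (by positivity), ← ENNReal.ofReal_mul (by positivity),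
        show -((1 + ‖y‖ ^ 2) * t) = -t + -(t * ‖y‖ ^ 2) by ring, Real.exp_add]
      congr 1
      ring
    simp only [h3]
    rw [lintegral_const_mul' _ _ ENNReal.ofReal_ne_top]
    refine (mul_le_mul_right (hK t ht F c) _).trans ?_
    rw [← ENNReal.ofReal_mul (by positivity)]
    refine ENNReal.ofReal_le_ofReal ?_
    have h4 : t ^ (3 / 2 : ℝ) * t ^ (-(3 / 2) : ℝ) = 1 := by
      rw [← Real.rpow_add ht]
      norm_num
    have h5 : (1 + 4 * t) ^ 3 ≤ 4096 * Real.exp (3 / 4 * t) := by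
      have h6 : 1 + 4 * t ≤ 16 * Real.exp (t / 4) := by
        linarith [Real.add_one_le_exp (t / 4)]
      calc (1 + 4 * t) ^ 3 ≤ (16 * Real.exp (t / 4)) ^ 3 := by gcongr
        _ = _ := by
          rw [mul_pow, ← Real.exp_nat_mul]
          norm_num
          ring_nf
    calc t ^ (3 / 2 : ℝ) * Real.exp (-t) * (t ^ (-(3 / 2) : ℝ) * (K * (1 + 4 * t) ^ 3 * S))
        = (t ^ (3 / 2 : ℝ) * t ^ (-(3 / 2) : ℝ)) * (K * S * ((1 + 4 * t) ^ 3 * Real.exp (-t))) := by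
          ring
      _ ≤ 1 * (K * S * ((4096 * Real.exp (3 / 4 * t)) * Real.exp (-t))) := by
          rw [h4]
          gcongr
      _ = _ := by
          rw [mul_assoc 4096, ← Real.exp_add]
          ring_nf
  refine (mul_le_mul_right (setLIntegral_mono (by fun_prop) h2) _).trans ?_
  rw [← ofReal_integral_eq_lintegral_ofReal
    ((integrableOn_exp_mul_Ioi (by norm_num) 0).const_mul _)
    (Filter.Eventually.of_forall fun t => by positivity), integral_const_mul,
    integral_exp_mul_Ioi (by norm_num), ← ENNReal.ofReal_mul (by positivity)]
  refine ENNReal.ofReal_le_ofReal (le_of_eq ?_)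
  norm_num
  ring

end RadialSobolev

/-! ### Pointwise control of the square function by the local mass. -/

namespace RadialSobolev

open MeasureTheory FourierTransform SchwartzMap
open scoped ENNReal ContDiff

/-- The mass of `f` near `x`: the convolution of `|f|²` with `(1 + |·|²)⁻²`. -/
noncomputable def localMass (f : L2) (x : R3) : ℝ≥0∞ :=
  ∫⁻ y, ENNReal.ofReal ((1 + ‖x - y‖ ^ 2) ^ 2)⁻¹ * ‖f y‖ₑ ^ 2

lemma measurable_coe (f : L2) : Measurable f := (Lp.stronglyMeasurable f).measurable

lemma exists_schwartz_sq_le (Φ : 𝓢(R3, ℂ)) :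
    ∃ D : ℝ, 0 ≤ D ∧ ∀ z, ‖Φ z‖ ^ 2 ≤
      D * ((1 + ‖z‖ ^ 2) ^ (-(5 / 2) : ℝ) * ((1 + ‖z‖ ^ 2) ^ 2)⁻¹) := by
  obtain ⟨E, hE⟩ : ∃ E : ℝ, ∀ z, (1 + ‖z‖) ^ 5 * ‖Φ z‖ ≤ E := by
    have h := one_add_le_sup_seminorm_apply (𝕜 := ℂ) (m := (5, 0)) (k := 5) (n := 0)
      le_rfl le_rfl Φ
    simp only [norm_iteratedFDeriv_zero] at h
    exact ⟨_, h⟩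
  refine ⟨E ^ 2, sq_nonneg _, fun z => ?_⟩
  have h1 : ((1 + ‖z‖) ^ 5 * ‖Φ z‖) ^ 2 ≤ E ^ 2 := pow_le_pow_left₀ (by positivity) (hE z) 2
  have hs : 1 ≤ 1 + ‖z‖ ^ 2 := by linarith [sq_nonneg ‖z‖]
  -- The total exponent `9/2` is rounded up to `5`, matching the square of the fifth-order decay of
  -- `Φ`.
  have h2 : (1 + ‖z‖ ^ 2) ^ (5 / 2 : ℝ) * (1 + ‖z‖ ^ 2) ^ 2 ≤ ((1 + ‖z‖) ^ 5) ^ 2 := by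
    calc (1 + ‖z‖ ^ 2) ^ (5 / 2 : ℝ) * (1 + ‖z‖ ^ 2) ^ 2
        ≤ (1 + ‖z‖ ^ 2) ^ (3 : ℝ) * (1 + ‖z‖ ^ 2) ^ 2 := by
          gcongr
          norm_num
      _ = (1 + ‖z‖ ^ 2) ^ 5 := by
          rw [show (3 : ℝ) = ((3 : ℕ) : ℝ) by norm_num, Real.rpow_natCast, ← pow_add]
      _ ≤ ((1 + ‖z‖) ^ 2) ^ 5 := by
          gcongr
          nlinarith [norm_nonneg z]
      _ = _ := by ring
  rw [Real.rpow_neg (by positivity), ← mul_inv, ← div_eq_mul_inv, le_div_iff₀ (by positivity)]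
  calc ‖Φ z‖ ^ 2 * ((1 + ‖z‖ ^ 2) ^ (5 / 2 : ℝ) * (1 + ‖z‖ ^ 2) ^ 2)
      ≤ ‖Φ z‖ ^ 2 * ((1 + ‖z‖) ^ 5) ^ 2 := by gcongr
    _ = ((1 + ‖z‖) ^ 5 * ‖Φ z‖) ^ 2 := by ring
    _ ≤ E ^ 2 := h1

/-- Weighted AM-GM, with the decay of `φ` shared between `p` and `g`. The parameter `δ` makes the
`p` term small enough to absorb. -/
lemma mul_mul_le_weighted {p φ g δ w D v : ℝ} (hp : 0 ≤ p) (hφ : 0 ≤ φ) (hg : 0 ≤ g)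
    (hδ : 0 < δ) (hw : 0 ≤ w) (hD : 0 ≤ D) (hv : 0 ≤ v) (h : φ ^ 2 ≤ D * (w * v)) :
    p * φ * g ≤ δ / 2 * (w * p ^ 2) + D / (2 * δ) * (v * g ^ 2) := by
  rw [← sq_le_sq₀ (by positivity) (by positivity)]
  calc (p * φ * g) ^ 2 = φ ^ 2 * (p ^ 2 * g ^ 2) := by ring
    _ ≤ D * (w * v) * (p ^ 2 * g ^ 2) := by gcongr
    _ = 4 * (δ / 2 * (w * p ^ 2)) * (D / (2 * δ) * (v * g ^ 2)) := by field_simp; ring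
    _ ≤ _ := four_mul_le_sq_add _ _

/-- The square function is pointwise dominated by the local mass. -/
lemma exists_tsum_piece_le {ψ : R3 → ℝ} (hψ : IsUnitWindow ψ) :
    ∃ A : ℝ, 0 ≤ A ∧ ∀ (f : L2) (x : R3),
      ∑' k : Fin 3 → ℤ, ‖piece ψ k f x‖ₑ ^ (2 : ℝ) ≤ ENNReal.ofReal A * localMass f x := by
  obtain ⟨Φ, hΦ⟩ := exists_piece_eq_integral hψ
  obtain ⟨D, hD0, hD⟩ := exists_schwartz_sq_le Φ
  obtain ⟨B, hB0, hB⟩ := exists_lintegral_weight_mul_trigPoly_le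
  -- The choice `δ = (B + 1)⁻¹` gives `δ B / 2 ≤ 1 / 2`, so at most `S / 2` lands on the right; the
  -- leading `2` comes from absorbing it.
  refine ⟨2 * (D / (2 * (B + 1)⁻¹)), by positivity, fun f x => ?_⟩
  rw [ENNReal.tsum_eq_iSup_sum]
  refine iSup_le fun F => ?_
  -- Duality: these coefficients turn `∑ c_k f_k(x)` into `S` itself.
  set c : (Fin 3 → ℤ) → ℂ := fun k => (starRingEnd ℂ) (piece ψ k f x) with hc
  set S : ℝ := ∑ k ∈ F, ‖c k‖ ^ 2 with hS
  have hS0 : 0 ≤ S := Finset.sum_nonneg fun k _ => by positivity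
  have hsum : ∑ k ∈ F, ‖piece ψ k f x‖ₑ ^ (2 : ℝ) = ENNReal.ofReal S := by
    rw [hS, ENNReal.ofReal_sum_of_nonneg fun k _ => by positivity]
    refine Finset.sum_congr rfl fun k _ => ?_
    rw [hc, RCLike.norm_conj, ← ofReal_norm, ENNReal.ofReal_rpow_of_nonneg
      (norm_nonneg _) (by norm_num)]
    norm_num
  have hmem : MemLp (fun y => Φ (y - x)) 2 (volume : Measure R3) :=
    (Φ.memLp 2).comp_measurePreserving (measurePreserving_sub_right volume x)
  have hint (k : Fin 3 → ℤ) : Integrable fun y : R3 =>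
      Complex.exp (-(Complex.I * (inner ℝ (y - x) (latticePoint k) : ℝ))) *
          Φ (y - x) * f y := by
    simp only [mul_assoc]
    refine (hmem.integrable_mul (Lp.memLp f)).bdd_mul (c := 1) (by fun_prop)
      (Filter.Eventually.of_forall fun y => ?_)
    rw [← neg_mul, mul_comm, ← mul_neg_one, ← mul_assoc]
    simp [Complex.norm_exp]
  have hSint : (S : ℂ) = ∫ y, trigPoly F c (y - x) * Φ (y - x) * f y := by
    have h1 : (S : ℂ) = ∑ k ∈ F, c k * piece ψ k f x := by
      rw [hS, Complex.ofReal_sum]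
      refine Finset.sum_congr rfl fun k _ => ?_
      rw [hc, RCLike.norm_conj, ← Complex.normSq_eq_norm_sq, Complex.normSq_eq_conj_mul_self]
    rw [h1]
    simp only [hΦ, ← integral_const_mul]
    rw [← integral_finsetSum _ fun k _ => (hint k).const_mul _]
    refine integral_congr_ae (Filter.Eventually.of_forall fun y => ?_)
    simp only [trigPoly, Finset.sum_mul, mul_assoc]
  have hle : ENNReal.ofReal S ≤ ENNReal.ofReal (S / 2) +
      ENNReal.ofReal (D / (2 * (B + 1)⁻¹)) * localMass f x := by
    have h1 : ENNReal.ofReal S = ‖(S : ℂ)‖ₑ := by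
      rw [← ofReal_norm, Complex.norm_real, Real.norm_of_nonneg hS0]
    rw [h1, hSint]
    refine (enorm_integral_le_lintegral_enorm _).trans ?_
    have h2 (y : R3) : ‖trigPoly F c (y - x) * Φ (y - x) * f y‖ₑ ≤
        ENNReal.ofReal ((B + 1)⁻¹ / 2) * ENNReal.ofReal
          ((1 + ‖y - x‖ ^ 2) ^ (-(5 / 2) : ℝ) * ‖trigPoly F c (y - x)‖ ^ 2) +
        ENNReal.ofReal (D / (2 * (B + 1)⁻¹)) *
          (ENNReal.ofReal ((1 + ‖x - y‖ ^ 2) ^ 2)⁻¹ * ‖f y‖ₑ ^ 2) := by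
      rw [← ofReal_norm, ← ofReal_norm, ← ENNReal.ofReal_pow (norm_nonneg _),
        ← ENNReal.ofReal_mul (by positivity), ← ENNReal.ofReal_mul (by positivity),
        ← ENNReal.ofReal_mul (by positivity), ← ENNReal.ofReal_add (by positivity)
        (by positivity), norm_mul, norm_mul, norm_sub_rev x y]
      exact ENNReal.ofReal_le_ofReal (mul_mul_le_weighted (norm_nonneg _) (norm_nonneg _)
        (norm_nonneg _) (by positivity) (by positivity) hD0 (by positivity) (hD _))
    refine (lintegral_mono h2).trans ?_
    have hf := measurable_coe f
    rw [lintegral_add_right _ (by fun_prop), lintegral_const_mul' _ _ ENNReal.ofReal_ne_top,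
      lintegral_const_mul' _ _ ENNReal.ofReal_ne_top,
      lintegral_sub_right_eq_self (fun y : R3 => ENNReal.ofReal
          ((1 + ‖y‖ ^ 2) ^ (-(5 / 2) : ℝ) * ‖trigPoly F c y‖ ^ 2)) x]
    refine add_le_add ((mul_le_mul_right (hB F c) _).trans ?_) le_rfl
    rw [← ENNReal.ofReal_mul (by positivity)]
    refine ENNReal.ofReal_le_ofReal ?_
    have h3 : (B + 1)⁻¹ * B ≤ 1 := by
      rw [inv_mul_le_iff₀ (by positivity)]
      linarith
    calc (B + 1)⁻¹ / 2 * (B * S) = ((B + 1)⁻¹ * B) * (S / 2) := by ring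
      _ ≤ 1 * (S / 2) := by gcongr
      _ = S / 2 := one_mul _
  -- Absorption is legitimate because the partial sum `S` over the finite set `F` is finite.
  have hhalf : ENNReal.ofReal (S / 2) ≤ ENNReal.ofReal (D / (2 * (B + 1)⁻¹)) * localMass f x := by
    have h1 : ENNReal.ofReal S = ENNReal.ofReal (S / 2) + ENNReal.ofReal (S / 2) := by
      rw [← ENNReal.ofReal_add (by positivity) (by positivity), add_halves]
    rw [h1] at hle
    exact (ENNReal.add_le_add_iff_left ENNReal.ofReal_ne_top).mp hle
  calc ∑ k ∈ F, ‖piece ψ k f x‖ₑ ^ (2 : ℝ) = ENNReal.ofReal 2 * ENNReal.ofReal (S / 2) := by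
        rw [hsum, ← ENNReal.ofReal_mul (by norm_num)]
        congr 1
        ring
    _ ≤ _ := by
        rw [ENNReal.ofReal_mul (by norm_num), mul_assoc]
        gcongr

end RadialSobolev

/-! ### Decay and total size of the local mass for radial functions. -/

namespace RadialSobolev

open MeasureTheory
open scoped ENNReal ContDiff

/-- The local mass of a radial function is radial. -/
lemma IsRadial.localMass_eq {f : L2} (hf : IsRadial f) {x p : R3} (h : ‖x‖ = ‖p‖) :
    localMass f x = localMass f p := by
  obtain ⟨f₀, hf₀⟩ := hf
  -- Reflection in the plane orthogonal to `x - p` swaps `x` and `p`, since they have equal norms.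
  let R : R3 ≃ₗᵢ[ℝ] R3 := (Submodule.span ℝ {x - p})ᗮ.reflection
  have hR : R x = p := Submodule.reflection_sub h
  have hmp : MeasurePreserving R := R.measurePreserving
  have hemb : MeasurableEmbedding R := R.toHomeomorph.measurableEmbedding
  have hae : ∀ᵐ z, f (R z) = f z := by
    filter_upwards [hf₀, hmp.quasiMeasurePreserving.ae hf₀] with z h1 h2
    rw [h1, h2, R.norm_map]
  unfold localMass
  symm
  rw [← hmp.lintegral_comp_emb hemb]
  refine lintegral_congr_ae ?_
  filter_upwards [hae] with z hz
  rw [hz, ← hR, ← map_sub, R.norm_map]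

lemma lintegral_inv_one_add_sub_sq (u : ℝ) :
    ∫⁻ a : ℝ, ENNReal.ofReal (1 + (a - u) ^ 2)⁻¹ = ENNReal.ofReal Real.pi := by
  rw [lintegral_sub_right_eq_self (fun a : ℝ => ENNReal.ofReal (1 + a ^ 2)⁻¹) u,
    ← ofReal_integral_eq_lintegral_ofReal integrable_inv_one_add_sq
      (Filter.Eventually.of_forall fun a => by positivity), integral_univ_inv_one_add_sq]

lemma lintegral_lintegral_coord {H : R3 → ℝ≥0∞} (hH : Measurable H) (i : Fin 3) :
    ∫⁻ a : ℝ, ∫⁻ y, ENNReal.ofReal (1 + (a - y i) ^ 2)⁻¹ * H y =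
      ENNReal.ofReal Real.pi * ∫⁻ y, H y := by
  rw [lintegral_lintegral_swap (by fun_prop), ← lintegral_const_mul _ hH]
  refine lintegral_congr fun y => ?_
  rw [lintegral_mul_const _ (by fun_prop), lintegral_inv_one_add_sub_sq]

/-- Separates the kernel into factors integrable along two coordinates, the number needed to average
over a surface. -/
lemma inv_sq_one_add_norm_sq_le (z : R3) :
    ((1 + ‖z‖ ^ 2) ^ 2)⁻¹ ≤ (1 + (z 0) ^ 2)⁻¹ * (1 + (z 1) ^ 2)⁻¹ := by
  rw [← mul_inv]
  refine inv_anti₀ (by positivity) ?_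
  rw [EuclideanSpace.real_norm_sq_eq, Fin.sum_univ_three, sq (1 + _)]
  have h0 := sq_nonneg (z 0)
  have h1 := sq_nonneg (z 1)
  have h2 := sq_nonneg (z 2)
  gcongr <;> linarith

/-- Pointwise decay of the local mass of a radial function. -/
lemma IsRadial.enorm_sq_mul_localMass_le {f : L2} (hf : IsRadial f) (x : R3) :
    ‖x‖ₑ ^ 2 * localMass f x ≤ ENNReal.ofReal (4 * Real.pi ^ 2) * ∫⁻ y, ‖f y‖ₑ ^ 2 := by
  set r := ‖x‖ with hr
  have hr0 : 0 ≤ r := norm_nonneg x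
  have hfm := measurable_coe f
  -- The sphere of radius `r` is a graph over the square `[0, r/2]²`, and by radiality `x` may be
  -- moved to the point above any `(a, b)`.
  have hpt : ∀ a ∈ Set.Icc 0 (r / 2), ∀ b ∈ Set.Icc 0 (r / 2),
      localMass f x ≤ ∫⁻ y, ENNReal.ofReal (1 + (b - y 1) ^ 2)⁻¹ *
        (ENNReal.ofReal (1 + (a - y 0) ^ 2)⁻¹ * ‖f y‖ₑ ^ 2) := by
    intro a ha b hb
    have hs : 0 ≤ r ^ 2 - a ^ 2 - b ^ 2 := by nlinarith [ha.1, ha.2, hb.1, hb.2]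
    let p : R3 := !₂[a, b, Real.sqrt (r ^ 2 - a ^ 2 - b ^ 2)]
    have hp : ‖x‖ = ‖p‖ := by
      rw [← sq_eq_sq₀ (norm_nonneg _) (norm_nonneg _), EuclideanSpace.real_norm_sq_eq p,
        Fin.sum_univ_three]
      simp only [p, Matrix.cons_val]
      rw [Real.sq_sqrt hs, ← hr]
      ring
    rw [hf.localMass_eq hp]
    refine lintegral_mono fun y => ?_
    rw [← mul_assoc, ← ENNReal.ofReal_mul (by positivity), mul_comm (1 + (b - y 1) ^ 2)⁻¹]
    gcongr
    exact inv_sq_one_add_norm_sq_le (p - y)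
  have hvol : volume (Set.Icc 0 (r / 2)) = ENNReal.ofReal (r / 2) := by
    rw [Real.volume_Icc, sub_zero]
  -- Integrating over the square gains `(r/2)²` on the left, while each coordinate integral costs
  -- `π` on the right.
  have hkey : ENNReal.ofReal (r / 2) * (ENNReal.ofReal (r / 2) * localMass f x) ≤
      ENNReal.ofReal Real.pi * (ENNReal.ofReal Real.pi * ∫⁻ y, ‖f y‖ₑ ^ 2) := by
    have h1 : ∀ a ∈ Set.Icc 0 (r / 2), ENNReal.ofReal (r / 2) * localMass f x ≤
        ENNReal.ofReal Real.pi * ∫⁻ y, ENNReal.ofReal (1 + (a - y 0) ^ 2)⁻¹ * ‖f y‖ₑ ^ 2 := by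
      intro a ha
      rw [← lintegral_lintegral_coord (by fun_prop) 1, mul_comm, ← hvol, ← setLIntegral_const]
      exact (setLIntegral_mono' measurableSet_Icc (hpt a ha)).trans (setLIntegral_le_lintegral _ _)
    rw [← lintegral_lintegral_coord (by fun_prop) 0,
      ← lintegral_const_mul' _ _ ENNReal.ofReal_ne_top, mul_comm]
    nth_rewrite 2 [← hvol]
    rw [← setLIntegral_const]
    exact (setLIntegral_mono' measurableSet_Icc h1).trans (setLIntegral_le_lintegral _ _)
  have hx : ‖x‖ₑ ^ 2 = ENNReal.ofReal 4 * (ENNReal.ofReal (r / 2) * ENNReal.ofReal (r / 2)) := by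
    rw [← ofReal_norm, ← ENNReal.ofReal_pow (norm_nonneg _),
      ← ENNReal.ofReal_mul (by positivity), ← ENNReal.ofReal_mul (by positivity)]
    congr 1
    ring
  rw [hx, ENNReal.ofReal_mul (by positivity), sq, ENNReal.ofReal_mul (by positivity)]
  simp only [mul_assoc]
  gcongr

/-- The total local mass. -/
lemma exists_lintegral_localMass_eq :
    ∃ c : ℝ, 0 ≤ c ∧ ∀ f : L2, ∫⁻ x, localMass f x = ENNReal.ofReal c * ∫⁻ y, ‖f y‖ₑ ^ 2 := by
  have hint : Integrable fun z : R3 => ((1 + ‖z‖ ^ 2) ^ 2)⁻¹ := by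
    have h := integrable_rpow_neg_one_add_norm_sq (E := R3) (μ := volume) (r := 4)
      (by simp; norm_num)
    refine h.congr (Filter.Eventually.of_forall fun z => ?_)
    have : (0 : ℝ) ≤ 1 + ‖z‖ ^ 2 := by positivity
    simp only
    rw [show (-4 / 2 : ℝ) = -((2 : ℕ) : ℝ) by norm_num, Real.rpow_neg this, Real.rpow_natCast]
  refine ⟨∫ z : R3, ((1 + ‖z‖ ^ 2) ^ 2)⁻¹, integral_nonneg fun z => by positivity, fun f => ?_⟩
  have hfm := measurable_coe f
  unfold localMass
  rw [lintegral_lintegral_swap (by fun_prop), ← lintegral_const_mul _ (by fun_prop)]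
  refine lintegral_congr fun y => ?_
  rw [lintegral_mul_const _ (by fun_prop),
    lintegral_sub_right_eq_self (fun z : R3 => ENNReal.ofReal ((1 + ‖z‖ ^ 2) ^ 2)⁻¹) y,
    ofReal_integral_eq_lintegral_ofReal hint (Filter.Eventually.of_forall fun z => by positivity)]

end RadialSobolev

/-! ### Interpolation and conclusion. -/

namespace RadialSobolev

open MeasureTheory
open scoped ENNReal ContDiff

lemma lintegral_enorm_sq (f : L2) : ∫⁻ y, ‖f y‖ₑ ^ 2 = ENNReal.ofReal (‖f‖ ^ 2) := by
  rw [ENNReal.ofReal_pow (norm_nonneg _), ofReal_norm, Lp.enorm_def,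
    eLpNorm_eq_lintegral_rpow_enorm_toReal (by norm_num) (by norm_num), ← ENNReal.rpow_natCast,
    ← ENNReal.rpow_mul]
  simp

/-- Interpolation between a pointwise bound for `|x| S(x)` and an `L²` bound for `S`. -/
lemma eLpNorm_weight_mul_le {S : R3 → ℝ≥0∞} {M : ℝ≥0∞} (hM : M ≠ ⊤)
    (hpt : ∀ x, ‖x‖ₑ * S x ≤ M) (hL2 : ∫⁻ x, S x ^ (2 : ℝ) ≤ M ^ (2 : ℝ))
    (r : ℝ≥0∞) (hr : 2 ≤ r) :
    eLpNorm (fun x : R3 => ‖x‖ₑ ^ (1 - 2 * (r⁻¹).toReal) * S x) r volume ≤ M := by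
  rcases eq_or_ne r ⊤ with rfl | hrtop
  · rw [eLpNorm_exponent_top]
    refine essSup_le_of_ae_le _ (Filter.Eventually.of_forall fun x => ?_)
    simpa using hpt x
  have hr0 : r ≠ 0 := (lt_of_lt_of_le (by norm_num) hr).ne'
  set q := r.toReal with hq
  have hq2 : 2 ≤ q := by
    have := ENNReal.toReal_mono hrtop hr
    simpa using this
  have hq0 : q ≠ 0 := by linarith
  rw [eLpNorm_eq_lintegral_rpow_enorm_toReal hr0 hrtop, ENNReal.toReal_inv, ← hq]
  have hpow (s : ℝ≥0∞) : s ^ q = s ^ (q - 2) * s ^ (2 : ℝ) := by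
    rw [← ENNReal.rpow_add_of_nonneg _ _ (by linarith) (by norm_num), sub_add_cancel]
  -- The weight is exactly the one for which the `q`-th power splits as `(|x| S)^(q-2) S²`.
  have hbound (x : R3) : ‖‖x‖ₑ ^ (1 - 2 * q⁻¹) * S x‖ₑ ^ q ≤ M ^ (q - 2) * S x ^ (2 : ℝ) := by
    rw [enorm_eq_self, ENNReal.mul_rpow_of_nonneg _ _ (by linarith), ← ENNReal.rpow_mul,
      show (1 - 2 * q⁻¹) * q = q - 2 by field_simp, hpow (S x), ← mul_assoc,
      ← ENNReal.mul_rpow_of_nonneg _ _ (by linarith)]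
    gcongr
    exact hpt x
  have htop : M ^ (q - 2) ≠ ⊤ := ENNReal.rpow_ne_top_of_nonneg (by linarith) hM
  calc (∫⁻ x, ‖‖x‖ₑ ^ (1 - 2 * q⁻¹) * S x‖ₑ ^ q) ^ (1 / q)
      ≤ (M ^ q) ^ (1 / q) := by
        refine ENNReal.rpow_le_rpow ?_ (by positivity)
        refine (lintegral_mono hbound).trans ?_
        rw [lintegral_const_mul' _ _ htop, hpow M]
        gcongr
    _ = M := by rw [← ENNReal.rpow_mul, mul_one_div_cancel hq0, ENNReal.rpow_one]

/-- The square function of a radial function is controlled by its `L²` norm alone. -/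
lemma exists_eLpNorm_squareFunction_le {ψ : R3 → ℝ} (hψ : IsUnitWindow ψ) :
    ∃ C : ℝ, 0 < C ∧ ∀ (r : ℝ≥0∞), 2 ≤ r → ∀ f : L2, IsRadial f →
      eLpNorm (fun x : R3 => ‖x‖ₑ ^ (1 - 2 * (r⁻¹).toReal) * squareFunction ψ f x) r volume
        ≤ ENNReal.ofReal (C * ‖f‖) := by
  obtain ⟨A, hA0, hA⟩ := exists_tsum_piece_le hψ
  obtain ⟨c, hc0, hc⟩ := exists_lintegral_localMass_eq
  -- `C²` dominates the constants of both endpoints; the `+ 1` keeps `C` positive.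
  set C := Real.sqrt (A * (4 * Real.pi ^ 2 + c)) + 1 with hC
  have hAC : A * (4 * Real.pi ^ 2 + c) ≤ C ^ 2 := by
    have h1 := Real.sq_sqrt (show 0 ≤ A * (4 * Real.pi ^ 2 + c) by positivity)
    nlinarith [Real.sqrt_nonneg (A * (4 * Real.pi ^ 2 + c))]
  have hC0 : 0 < C := by positivity
  refine ⟨C, hC0, fun r hr f hf => ?_⟩
  have hS (x : R3) : squareFunction ψ f x ^ (2 : ℝ) ≤ ENNReal.ofReal A * localMass f x := by
    rw [squareFunction, ← ENNReal.rpow_mul]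
    norm_num
    simpa using hA f x
  have hM : ENNReal.ofReal (C * ‖f‖) ^ (2 : ℝ) = ENNReal.ofReal (C ^ 2 * ‖f‖ ^ 2) := by
    rw [ENNReal.ofReal_rpow_of_nonneg (by positivity) (by norm_num), Real.rpow_two, mul_pow]
  refine eLpNorm_weight_mul_le ENNReal.ofReal_ne_top (fun x => ?_) ?_ r hr
  · rw [← ENNReal.rpow_le_rpow_iff (show (0 : ℝ) < 2 by norm_num),
      ENNReal.mul_rpow_of_nonneg _ _ (by norm_num), hM]
    calc ‖x‖ₑ ^ (2 : ℝ) * squareFunction ψ f x ^ (2 : ℝ)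
        ≤ ‖x‖ₑ ^ (2 : ℝ) * (ENNReal.ofReal A * localMass f x) := by gcongr; exact hS x
      _ = ENNReal.ofReal A * (‖x‖ₑ ^ 2 * localMass f x) := by
          rw [ENNReal.rpow_two]
          ring
      _ ≤ ENNReal.ofReal A * (ENNReal.ofReal (4 * Real.pi ^ 2) * ENNReal.ofReal (‖f‖ ^ 2)) := by
          rw [← lintegral_enorm_sq]
          exact mul_le_mul_right (hf.enorm_sq_mul_localMass_le x) _
      _ ≤ _ := by
          rw [← ENNReal.ofReal_mul (by positivity), ← ENNReal.ofReal_mul (by positivity),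
            ← mul_assoc]
          gcongr
          exact le_trans (by gcongr; linarith) hAC
  · rw [hM]
    refine (lintegral_mono hS).trans ?_
    rw [lintegral_const_mul' _ _ ENNReal.ofReal_ne_top, hc, lintegral_enorm_sq,
      ← ENNReal.ofReal_mul (by positivity), ← ENNReal.ofReal_mul (by positivity), ← mul_assoc]
    gcongr
    refine le_trans ?_ hAC
    gcongr
    linarith [show 0 ≤ 4 * Real.pi ^ 2 by positivity]

end RadialSobolev

theorem lemma3p4 (ψ : RadialSobolev.R3 → ℝ) (hψ : RadialSobolev.IsUnitWindow ψ)
    (ε : ℝ) (hε : 0 < ε) :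
    ∃ C : ℝ, 0 < C ∧
      ∀ (r : ENNReal), 2 ≤ r →
      ∀ (f : RadialSobolev.L2), RadialSobolev.IsRadial f →
      ∀ (hf : RadialSobolev.MemH ε f),
        MeasureTheory.eLpNorm
            (fun x : RadialSobolev.R3 =>
              ‖x‖ₑ ^ (1 - 2 * (r⁻¹).toReal) * RadialSobolev.squareFunction ψ f x)
            r MeasureTheory.volume
          ≤ ENNReal.ofReal (C * RadialSobolev.normH ε f hf) := by
  obtain ⟨C, hC0, hC⟩ := RadialSobolev.exists_eLpNorm_squareFunction_le hψ
  refine ⟨C, hC0, fun r hr f hrad hf => (hC r hr f hrad).trans ?_⟩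
  refine ENNReal.ofReal_le_ofReal (mul_le_mul_of_nonneg_left ?_ hC0.le)
  exact le_add_of_nonneg_right (norm_nonneg _)
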